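/- **Setting.** Let $(\Omega,\mathcal{F},\mu)$ be a complete $\sigma$-finite measure space, let $(\mathsf{H}_\omega)_{\omega\in\Omega}$ be a family of real Hilbert spaces, and let $\mathfrak{G}$ be a vector subspace of $\prod_{\omega\in\Omega}\mathsf{H}_\omega$ such that * for every $x\in\mathfrak{G}$, the function $\omega\mapsto\|x(\omega)\|_{\mathsf{H}_\omega}$ is $\mathcal{F}$-measurable; * if $x\in\prod_{\omega\in\Omega}\mathsf{H}_\omega$ is such that, for every $y\in\mathfrak{G}$, the function $\omega\mapsto\langle x(\omega)\mid y(\omega)\rangle_{\mathsf{H}_\omega}$ is $\mathcal{F}$-measurable, then $x\in\mathfrak{G}$; * there exists a sequence $(e_n)_{n\in\mathbb{N}}$ in $\mathfrak{G}$ such that, for every $\omega\in\Omega$, the closed linear span of $\{e_n(\omega)\}_{n\in\mathbb{N}}$ is $\mathsf{H}_\omega$. Set $\mathfrak{H}=\{x\in\mathfrak{G} : \int_\Omega\|x(\omega)\|^2_{\mathsf{H}_\omega}\,\mu(d\omega)<+\infty\}$ and let $\mathcal{H}$ be the Hilbert space of classes of $\mu$-a.e. equal elements of $\mathfrak{H}$,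 with scalar product $\langle x\mid y\rangle_{\mathcal{H}}=\int_\Omega\langle x(\omega)\mid y(\omega)\rangle_{\mathsf{H}_\omega}\,\mu(d\omega)$. The same symbol denotes a class and a representative of it in $\mathfrak{H}$. The direct integral of sets $\mathsf{C}_\omega\subset\mathsf{H}_\omega$ is $$\int^\oplus_\Omega\mathsf{C}_\omega\,\mu(d\omega)=\{x\in\mathcal{H} : x(\omega)\in\mathsf{C}_\omega\text{ for }\mu\text{-a.e. }\omega\},$$ and the direct integral of set-valued operators $\mathsf{A}_\omega\colon\mathsf{H}_\omega\to 2^{\mathsf{H}_\omega}$ is the operator $$\int^\oplus_\Omega\mathsf{A}_\omega\,\mu(d\omega)\colon\mathcal{H}\to 2^{\mathcal{H}}\colon x\mapsto\{x^*\in\mathcal{H} : x^*(\omega)\in\mathsf{A}_\omega(x(\omega))\text{ for }\mu\text{-a.e. }\omega\}.$$ For a set-valued operator $A$ on a real Hilbert space, $\operatorname{dom}A=\{x : Ax\neq\varnothing\}$, $\operatorname{ran}A=\bigcup_x Ax$, $J_A=(\mathrm{Id}+A)^{-1}$ is its resolvent and, for $\gamma\in\left]0,+\infty\right[$, ${}^{\gamma}\!A=(\mathrm{Id}-J_{\gamma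 A})/\gamma$ is its Yosida approximation of index $\gamma$. If $A$ is maximally monotone, $J_{\gamma A}$ and ${}^{\gamma}\!A$ are single-valued and defined everywhere and, for $x\in\operatorname{dom}A$, ${}^{0}\!Ax$ denotes the element of minimal norm of $Ax$. **Theorem.** For every $\omega\in\Omega$, let $\mathsf{A}_\omega\colon\mathsf{H}_\omega\to 2^{\mathsf{H}_\omega}$ be maximally monotone. Suppose that, for every $x\in\mathfrak{H}$, the mapping $\omega\mapsto J_{\mathsf{A}_\omega}(x(\omega))$ lies in $\mathfrak{G}$, and that $A=\int^\oplus_\Omega\mathsf{A}_\omega\,\mu(d\omega)$ satisfies $\operatorname{dom}A\neq\varnothing$. Then the following hold: 1. $A$ is maximally monotone. 2. Let $\gamma\in\left]0,+\infty\right[$ and $x\in\mathfrak{H}$. Then (a) the mapping $\omega\mapsto J_{\gamma\mathsf{A}_\omega}(x(\omega))$ lies in $\mathfrak{H}$ and $J_{\gamma A}=\int^\oplus_\Omega J_{\gamma\mathsf{A}_\omega}\,\mu(d\omega)$; (b) the mapping $\omega\mapsto{}^{\gamma}\!\mathsf{A}_\omega(x(\omega))$ lies in $\mathfrak{H}$ and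 ${}^{\gamma}\!A=\int^\oplus_\Omega{}^{\gamma}\!\mathsf{A}_\omega\,\mu(d\omega)$. 3. $\overline{\operatorname{dom}}\,A=\int^\oplus_\Omega\overline{\operatorname{dom}}\,\mathsf{A}_\omega\,\mu(d\omega)=\overline{\int^\oplus_\Omega\operatorname{dom}\mathsf{A}_\omega\,\mu(d\omega)}$. 4. $\overline{\operatorname{ran}}\,A=\int^\oplus_\Omega\overline{\operatorname{ran}}\,\mathsf{A}_\omega\,\mu(d\omega)=\overline{\int^\oplus_\Omega\operatorname{ran}\mathsf{A}_\omega\,\mu(d\omega)}$. 5. Let $x\in\mathfrak{H}$ be such that $x(\omega)\in\operatorname{dom}\mathsf{A}_\omega$ for every $\omega\in\Omega$. Then (a) the mapping $\omega\mapsto{}^{0}\!\mathsf{A}_\omega(x(\omega))$ lies in $\mathfrak{G}$; (b) if $x\in\operatorname{dom}A$, then the mapping $\omega\mapsto{}^{0}\!\mathsf{A}_\omega(x(\omega))$ lies in $\mathfrak{H}$ and its class is ${}^{0}\!Ax$. -/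

import Mathlib

open MeasureTheory
open scoped Pointwise

/-! ### Set-valued operators on a real Hilbert space -/

namespace SetOp

section

variable {E : Type*} [NormedAddCommGroup E] [InnerProductSpace ℝ E]

/-- The graph of `A : E → 2 ^ E`. -/
def gra (A : E → Set E) : Set (E × E) := {z | z.2 ∈ A z.1}

/-- The domain of `A`. -/
def dom (A : E → Set E) : Set E := {x | (A x).Nonempty}

/-- The range of `A`. -/
def ran (A : E → Set E) : Set E := ⋃ x ∈ dom A, A x

/-- The inverse of `A`. -/
def inv (A : E → Set E) : E → Set E := fun y => {x | y ∈ A x}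

/-- Monotone operators. -/
def IsMonotone (A : E → Set E) : Prop :=
  ∀ x y : E, ∀ x' ∈ A x, ∀ y' ∈ A y, 0 ≤ inner ℝ (x - y) (x' - y')

/-- Maximally monotone operators: monotone, without a proper monotone extension. -/
def IsMaximallyMonotone (A : E → Set E) : Prop :=
  IsMonotone A ∧ ¬ ∃ B : E → Set E, IsMonotone B ∧ gra A ⊆ gra B ∧ gra B ≠ gra A

/-- The resolvent `J_A = (Id + A)⁻¹`, as a set-valued operator. -/
def resolvent (A : E → Set E) : E → Set E := inv fun x => {x} + A x

/-- The Yosida approximation `(Id - J_{γ A}) / γ`, as a set-valued operator. -/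
def yosida (γ : ℝ) (A : E → Set E) : E → Set E :=
  fun x => γ⁻¹ • ({x} - resolvent (γ • A) x)

/-- The set of the projections (points at minimal distance) of `x` onto `C`;
a singleton if `C` is nonempty, closed and convex in a Hilbert space. -/
def proj (C : Set E) (x : E) : Set E := {p | p ∈ C ∧ ∀ q ∈ C, ‖x - p‖ ≤ ‖x - q‖}

/-- The minimal-norm selection `x ↦ proj_{A x} 0`. -/
def minSel (A : E → Set E) : E → Set E := fun x => proj (A x) 0

end

end SetOp

/-! ### Measurable fields of Hilbert spaces and their direct integrals -/

/-- A measurable vector field structure on the family `(H ω)`: a vector subspace `G` of the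
product satisfying the three axioms. -/
structure MeasurableVectorField {Ω : Type*} [MeasurableSpace Ω] (H : Ω → Type*)
    [∀ ω, NormedAddCommGroup (H ω)] [∀ ω, InnerProductSpace ℝ (H ω)] where
  /-- The space of measurable vector fields. -/
  G : Submodule ℝ (∀ ω, H ω)
  measurable_norm : ∀ x ∈ G, Measurable fun ω => ‖x ω‖
  mem_of_measurable_inner : ∀ x : ∀ ω, H ω,
    (∀ y ∈ G, Measurable fun ω => (inner ℝ (x ω) (y ω) : ℝ)) → x ∈ G
  exists_total : ∃ e : ℕ → ∀ ω, H ω, (∀ n, e n ∈ G) ∧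
    ∀ ω, (Submodule.span ℝ (Set.range fun n => e n ω)).topologicalClosure = ⊤

namespace MeasurableVectorField

section

variable {Ω : Type*} [MeasurableSpace Ω] {H : Ω → Type*}
  [∀ ω, NormedAddCommGroup (H ω)] [∀ ω, InnerProductSpace ℝ (H ω)]

theorem measurable_inner (V : MeasurableVectorField H) {x y : ∀ ω, H ω} (hx : x ∈ V.G)
    (hy : y ∈ V.G) : Measurable fun ω => (inner ℝ (x ω) (y ω) : ℝ) := by
  have h1 := V.measurable_norm _ (V.G.add_mem hx hy)
  have h2 := V.measurable_norm _ (V.G.sub_mem hx hy)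
  have h : (fun ω => (inner ℝ (x ω) (y ω) : ℝ)) = fun ω =>
      (‖(x + y) ω‖ * ‖(x + y) ω‖ - ‖(x - y) ω‖ * ‖(x - y) ω‖) / 4 := by
    funext ω
    have h3 := norm_add_mul_self_real (x ω) (y ω)
    have h4 := norm_sub_mul_self_real (x ω) (y ω)
    change _ = (‖x ω + y ω‖ * ‖x ω + y ω‖ - ‖x ω - y ω‖ * ‖x ω - y ω‖) / 4
    linarith
  rw [h]
  exact ((h1.mul h1).sub (h2.mul h2)).div_const 4

/-- The space of the square-integrable fields in `G`. -/
def sqInt (V : MeasurableVectorField H) (μ : Measure Ω) : Submodule ℝ (∀ ω, H ω) where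
  carrier := {x | x ∈ V.G ∧ ∫⁻ ω, ‖x ω‖ₑ ^ 2 ∂μ < ⊤}
  zero_mem' := ⟨V.G.zero_mem, by simp⟩
  add_mem' := by
    rintro x y ⟨hx, hx'⟩ ⟨hy, hy'⟩
    refine ⟨V.G.add_mem hx hy, ?_⟩
    have hm : Measurable fun ω => 2 * ‖x ω‖ₑ ^ 2 := by
      have h := (V.measurable_norm x hx).enorm
      simp only [enorm_norm] at h
      exact (h.pow_const 2).const_mul 2
    calc ∫⁻ ω, ‖(x + y) ω‖ₑ ^ 2 ∂μ
        ≤ ∫⁻ ω, (2 * ‖x ω‖ₑ ^ 2 + 2 * ‖y ω‖ₑ ^ 2) ∂μ := by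
          refine lintegral_mono fun ω => ?_
          have h : ‖(x + y) ω‖ ^ 2 ≤ 2 * ‖x ω‖ ^ 2 + 2 * ‖y ω‖ ^ 2 := by
            have h1 : ‖(x + y) ω‖ ≤ ‖x ω‖ + ‖y ω‖ := norm_add_le _ _
            nlinarith [sq_nonneg (‖x ω‖ - ‖y ω‖), norm_nonneg ((x + y) ω)]
          have h' := ENNReal.ofReal_le_ofReal h
          rw [ENNReal.ofReal_add (by positivity) (by positivity),
            ENNReal.ofReal_mul (by norm_num), ENNReal.ofReal_mul (by norm_num),
            ENNReal.ofReal_pow (norm_nonneg _), ENNReal.ofReal_pow (norm_nonneg _),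
            ENNReal.ofReal_pow (norm_nonneg _)] at h'
          simpa [ofReal_norm] using h'
      _ = 2 * ∫⁻ ω, ‖x ω‖ₑ ^ 2 ∂μ + 2 * ∫⁻ ω, ‖y ω‖ₑ ^ 2 ∂μ := by
          rw [lintegral_add_left hm, lintegral_const_mul' _ _ (by simp),
            lintegral_const_mul' _ _ (by simp)]
      _ < ⊤ := ENNReal.add_lt_top.2
          ⟨ENNReal.mul_lt_top (by simp) hx', ENNReal.mul_lt_top (by simp) hy'⟩
  smul_mem' := by
    rintro c x ⟨hx, hx'⟩
    refine ⟨V.G.smul_mem c hx, ?_⟩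
    have h : ∀ ω, ‖(c • x) ω‖ₑ ^ 2 = ‖c‖ₑ ^ 2 * ‖x ω‖ₑ ^ 2 := fun ω => by
      rw [Pi.smul_apply, enorm_smul, mul_pow]
    simp only [h]
    rw [lintegral_const_mul' _ _ (by simp)]
    exact ENNReal.mul_lt_top (by simp) hx'

variable (V : MeasurableVectorField H) (μ : Measure Ω)

theorem integrable_norm_sq (x : V.sqInt μ) : Integrable (fun ω => ‖x.1 ω‖ ^ 2) μ := by
  refine ⟨((V.measurable_norm _ x.2.1).pow_const 2).aestronglyMeasurable, ?_⟩
  have h := x.2.2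
  simpa [HasFiniteIntegral, enorm_pow] using h

theorem integrable_inner (x y : V.sqInt μ) :
    Integrable (fun ω => (inner ℝ (x.1 ω) (y.1 ω) : ℝ)) μ := by
  refine ((V.integrable_norm_sq μ x).add (V.integrable_norm_sq μ y)).mono
    (V.measurable_inner x.2.1 y.2.1).aestronglyMeasurable (ae_of_all _ fun ω => ?_)
  have h1 := norm_inner_le_norm (𝕜 := ℝ) (x.1 ω) (y.1 ω)
  have h2 : ‖x.1 ω‖ * ‖y.1 ω‖ ≤ ‖x.1 ω‖ ^ 2 + ‖y.1 ω‖ ^ 2 := by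
    nlinarith [sq_nonneg (‖x.1 ω‖ - ‖y.1 ω‖), sq_nonneg (‖x.1 ω‖), sq_nonneg (‖y.1 ω‖)]
  exact (h1.trans h2).trans (le_abs_self _)

/-- The square-integrable fields that vanish almost everywhere. -/
def nullSub : Submodule ℝ (V.sqInt μ) where
  carrier := {x | ∀ᵐ ω ∂μ, x.1 ω = 0}
  zero_mem' := ae_of_all _ fun _ => rfl
  add_mem' := by
    intro x y hx hy
    change ∀ᵐ ω ∂μ, (x + y).1 ω = 0
    filter_upwards [hx, hy] with ω h1 h2
    change x.1 ω + y.1 ω = 0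
    rw [h1, h2, add_zero]
  smul_mem' := by
    intro c x hx
    change ∀ᵐ ω ∂μ, (c • x).1 ω = 0
    filter_upwards [hx] with ω h1
    change c • x.1 ω = 0
    rw [h1, smul_zero]

/-- The Hilbert direct integral of the family `(H ω)`: the classes of almost everywhere equal
square-integrable fields. -/
def DirectIntegral : Type _ := V.sqInt μ ⧸ V.nullSub μ

noncomputable instance : AddCommGroup (V.DirectIntegral μ) :=
  inferInstanceAs (AddCommGroup (V.sqInt μ ⧸ V.nullSub μ))

noncomputable instance : Module ℝ (V.DirectIntegral μ) :=
  inferInstanceAs (Module ℝ (V.sqInt μ ⧸ V.nullSub μ))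

/-- The class of a square-integrable field. -/
def toClass : V.sqInt μ →ₗ[ℝ] V.DirectIntegral μ := (V.nullSub μ).mkQ

/-- A representative of a class. -/
noncomputable def rep (x : V.DirectIntegral μ) : V.sqInt μ :=
  Function.surjInv (f := V.toClass μ) (V.nullSub μ).mkQ_surjective x

theorem toClass_rep (x : V.DirectIntegral μ) : V.toClass μ (V.rep μ x) = x :=
  Function.surjInv_eq (f := V.toClass μ) (V.nullSub μ).mkQ_surjective x

theorem toClass_eq_toClass {x y : V.sqInt μ} : V.toClass μ x = V.toClass μ y ↔ ∀ᵐ ω ∂μ, x.1 ω = y.1 ω := by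
  refine (Submodule.Quotient.eq (V.nullSub μ)).trans ?_
  change (∀ᵐ ω ∂μ, x.1 ω - y.1 ω = 0) ↔ _
  simp only [sub_eq_zero]

theorem rep_toClass (x : V.sqInt μ) : ∀ᵐ ω ∂μ, (V.rep μ (V.toClass μ x)).1 ω = x.1 ω :=
  (V.toClass_eq_toClass μ).1 (V.toClass_rep μ _)

/-- The scalar product of the direct integral is `⟪x, y⟫ = ∫ ⟪x ω, y ω⟫ dμ`. -/
noncomputable instance instCore : InnerProductSpace.Core ℝ (V.DirectIntegral μ) where
  inner x y := ∫ ω, inner ℝ ((V.rep μ x).1 ω) ((V.rep μ y).1 ω) ∂μ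
  conj_inner_symm x y := by
    simp only [conj_trivial]
    exact integral_congr_ae (ae_of_all _ fun ω => real_inner_comm _ _)
  re_inner_nonneg x := by
    simp only [RCLike.re_to_real]
    exact integral_nonneg fun ω => real_inner_self_nonneg
  add_left x y z := by
    rw [← integral_add (V.integrable_inner μ _ _) (V.integrable_inner μ _ _)]
    have h : V.toClass μ (V.rep μ (x + y)) = V.toClass μ (V.rep μ x + V.rep μ y) := by
      rw [map_add, toClass_rep, toClass_rep, toClass_rep]
    refine integral_congr_ae ?_
    filter_upwards [(V.toClass_eq_toClass μ).1 h] with ω hω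
    rw [hω]
    exact inner_add_left _ _ _
  smul_left x y c := by
    rw [conj_trivial, ← integral_const_mul]
    have h : V.toClass μ (V.rep μ (c • x)) = V.toClass μ (c • V.rep μ x) := by
      rw [map_smul, toClass_rep, toClass_rep]
    refine integral_congr_ae ?_
    filter_upwards [(V.toClass_eq_toClass μ).1 h] with ω hω
    rw [hω]
    exact real_inner_smul_left _ _ _
  definite x hx := by
    have h := (integral_eq_zero_iff_of_nonneg (fun ω => real_inner_self_nonneg)
      (V.integrable_inner μ (V.rep μ x) (V.rep μ x))).1 hx
    rw [← V.toClass_rep μ x, ← map_zero (V.toClass μ), toClass_eq_toClass]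
    filter_upwards [h] with ω hω
    exact inner_self_eq_zero.1 hω

noncomputable instance : NormedAddCommGroup (V.DirectIntegral μ) :=
  (V.instCore μ).toNormedAddCommGroup

noncomputable instance : InnerProductSpace ℝ (V.DirectIntegral μ) :=
  InnerProductSpace.ofCore (V.instCore μ).toCore

/-- The Hilbert direct integral of a family of sets. -/
def setIntegral (C : ∀ ω, Set (H ω)) : Set (V.DirectIntegral μ) :=
  {x | ∀ᵐ ω ∂μ, (V.rep μ x).1 ω ∈ C ω}

/-- The Hilbert direct integral of a family of set-valued operators. -/
def opIntegral (A : ∀ ω, H ω → Set (H ω)) : V.DirectIntegral μ → Set (V.DirectIntegral μ) :=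
  fun x => {x' | ∀ᵐ ω ∂μ, (V.rep μ x').1 ω ∈ A ω ((V.rep μ x).1 ω)}

end

end MeasurableVectorField

/-! Everything is reduced to resolvents. Minty's theorem turns maximal monotonicity of a monotone
operator into surjectivity of `Id + A`, and the relation `γ⁻¹ • (x - p) ∈ A p` defining `J_{γA}` may
be tested fibre by fibre. So it suffices that the field of the points `J_{γA_ω}(x(ω))` be measurable
and square-integrable. Measurability is assumed for `γ = 1` only. A point `J_{δA} x` is the fixed
point of a contraction built on `J_{γA}` when `δ > γ / 2`, so Picard iteration carries measurability
from `γ` to `δ`, and finitely many such moves reach every index (`tendsto_iterate`, `resPt_mem_G`).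
Square-integrability comes from comparing with one fixed pair `(r, u)` in the graph of the direct
integral: `‖J_{γA} x - x‖² ≤ 8‖x - r‖² + 2γ²‖u‖²`. The same bound dominates the convergence `J_{γA}
x → x` as `γ → 0` on the closed domains, which gives the domain formula. The range formula is the
domain formula for the inverses, since `J_{A⁻¹} = Id - J_A`. The minimal-norm selection is the
pointwise limit of Yosida approximations, hence measurable; an inequality stronger than minimality
survives integration. -/

namespace SetOp

open Filter Topology

section

variable {E : Type*} [NormedAddCommGroup E] [InnerProductSpace ℝ E] {A : E → Set E}

/-! ### Maximality as a condition on pairs, and its stability -/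

/-- A pair monotonically related to the whole graph can be adjoined to it without losing
monotonicity, so maximality forces it to be in the graph already. -/
theorem isMaximallyMonotone_iff : IsMaximallyMonotone A ↔ IsMonotone A ∧
    ∀ x u : E, (∀ y, ∀ v ∈ A y, 0 ≤ inner ℝ (x - y) (u - v)) → u ∈ A x := by
  refine and_congr_right fun hm => ⟨fun h x u hxu => ?_, ?_⟩
  · by_contra hu
    refine h ⟨fun y => A y ∪ {v | y = x ∧ v = u}, ?_, fun z hz => Or.inl hz, fun heq => ?_⟩
    · rintro y z y' (hy | ⟨rfl, rfl⟩) z' (hz | ⟨rfl, rfl⟩)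
      · exact hm _ _ _ hy _ hz
      · have := hxu _ _ hy
        rwa [← neg_sub y, ← neg_sub y', inner_neg_neg] at this
      · exact hxu _ _ hz
      · simp
    · have : (x, u) ∈ gra A := heq ▸ (Or.inr ⟨rfl, rfl⟩ : u ∈ A x ∪ {v | x = x ∧ v = u})
      exact hu this
  · rintro h ⟨B, hB, hAB, hne⟩
    refine hne (Set.Subset.antisymm (fun z hz => h _ _ fun y v hv => ?_) hAB)
    exact hB _ _ _ hz _ (hAB (a := (y, v)) hv)

theorem IsMaximallyMonotone.mem (hA : IsMaximallyMonotone A) {x u : E}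
    (h : ∀ y, ∀ v ∈ A y, 0 ≤ inner ℝ (x - y) (u - v)) : u ∈ A x :=
  (isMaximallyMonotone_iff.1 hA).2 x u h

omit [InnerProductSpace ℝ E] in
theorem mem_resolvent {x p : E} : p ∈ resolvent A x ↔ x - p ∈ A p := by
  change x ∈ {p} + A p ↔ _
  rw [Set.singleton_add, Set.mem_image]
  exact ⟨by rintro ⟨a, ha, rfl⟩; simpa using ha, fun h => ⟨_, h, by simp⟩⟩

theorem mem_resolvent_smul {γ : ℝ} (hγ : 0 < γ) {x p : E} :
    p ∈ resolvent (γ • A) x ↔ γ⁻¹ • (x - p) ∈ A p := by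
  rw [mem_resolvent, Pi.smul_apply, Set.mem_smul_set_iff_inv_smul_mem₀ hγ.ne']

theorem mem_yosida {γ : ℝ} (hγ : 0 < γ) {x q : E} :
    q ∈ yosida γ A x ↔ x - γ • q ∈ resolvent (γ • A) x := by
  rw [yosida, Set.mem_smul_set_iff_inv_smul_mem₀ (inv_ne_zero hγ.ne'), inv_inv, Set.mem_sub]
  constructor
  · rintro ⟨_, rfl, b, hb, h⟩
    rw [← h]
    simpa using hb
  · intro h
    exact ⟨x, rfl, _, h, by simp⟩

theorem IsMaximallyMonotone.translate (hA : IsMaximallyMonotone A) (w : E) :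
    IsMaximallyMonotone fun p => A (p + w) := by
  refine isMaximallyMonotone_iff.2 ⟨fun x y x' hx y' hy => ?_, fun x u h => hA.mem fun y v hv => ?_⟩
  · simpa using hA.1 _ _ _ hx _ hy
  · have := h (y - w) v (by simpa using hv)
    rwa [sub_sub_eq_add_sub] at this

theorem IsMaximallyMonotone.inv (hA : IsMaximallyMonotone A) : IsMaximallyMonotone (inv A) := by
  refine isMaximallyMonotone_iff.2 ⟨fun x y x' hx y' hy => ?_, fun x u h => hA.mem fun y v hv => ?_⟩
  · rw [real_inner_comm]
    exact hA.1 _ _ _ hx _ hy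
  · rw [real_inner_comm]
    exact h _ _ hv

theorem IsMaximallyMonotone.smul (hA : IsMaximallyMonotone A) {γ : ℝ} (hγ : 0 < γ) :
    IsMaximallyMonotone (γ • A) := by
  refine isMaximallyMonotone_iff.2 ⟨?_, fun x u h => ?_⟩
  · rintro x y _ ⟨x', hx, rfl⟩ _ ⟨y', hy, rfl⟩
    change 0 ≤ inner ℝ (x - y) (γ • x' - γ • y')
    rw [← smul_sub, real_inner_smul_right]
    exact mul_nonneg hγ.le (hA.1 _ _ _ hx _ hy)
  · rw [Pi.smul_apply, Set.mem_smul_set_iff_inv_smul_mem₀ hγ.ne']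
    refine hA.mem fun y v hv => ?_
    have := mul_nonneg (inv_pos.2 hγ).le (h y (γ • v) (Set.smul_mem_smul_set hv))
    rwa [← real_inner_smul_right, smul_sub, smul_smul, inv_mul_cancel₀ hγ.ne', one_smul] at this

omit [NormedAddCommGroup E] [InnerProductSpace ℝ E] in
theorem dom_inv : dom (inv A) = ran A := by
  ext u
  simp only [ran, Set.mem_iUnion]
  exact ⟨fun ⟨x, hx⟩ => ⟨x, ⟨u, hx⟩, hx⟩, fun ⟨x, _, hx⟩ => ⟨x, hx⟩⟩

/-- The graph of a maximally monotone operator is sequentially closed. -/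
theorem IsMaximallyMonotone.mem_of_tendsto (hA : IsMaximallyMonotone A) {x u : ℕ → E} {x₀ u₀ : E}
    (hmem : ∀ n, u n ∈ A (x n)) (hx : Tendsto x atTop (𝓝 x₀)) (hu : Tendsto u atTop (𝓝 u₀)) :
    u₀ ∈ A x₀ :=
  hA.mem fun y v hv => ge_of_tendsto' ((hx.sub_const y).inner (hu.sub_const v))
    fun n => hA.1 _ _ _ (hmem n) _ hv

/-! ### Minty's theorem via the Fitzpatrick function -/

theorem nonneg_of_forall_add_mul_nonneg {a b : ℝ}
    (h : ∀ s : ℝ, 0 < s → s ≤ 1 → 0 ≤ s * a + s ^ 2 * b) : 0 ≤ a := by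
  have ht : Tendsto (fun n : ℕ => a + (1 / ((n : ℝ) + 1)) * b) atTop (𝓝 (a + 0 * b)) :=
    tendsto_const_nhds.add (tendsto_one_div_add_atTop_nhds_zero_nat.mul_const b)
  rw [zero_mul, add_zero] at ht
  refine ge_of_tendsto' ht fun n => ?_
  have hs : (0 : ℝ) < 1 / ((n : ℝ) + 1) := by positivity
  have h1 := h _ hs (by rw [div_le_one (by positivity)]; linarith [n.cast_nonneg (α := ℝ)])
  refine nonneg_of_mul_nonneg_right (a := 1 / ((n : ℝ) + 1)) ?_ hs
  linarith

theorem norm_sq_midpoint (a b : E) :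
    ‖(1 / 2 : ℝ) • (a + b)‖ ^ 2 = (‖a‖ ^ 2 + ‖b‖ ^ 2) / 2 - ‖a - b‖ ^ 2 / 4 := by
  rw [norm_smul, mul_pow, norm_add_sq_real, norm_sub_sq_real]
  norm_num
  ring

/-- The epigraph of the Fitzpatrick function of `A`. -/
def fitzpatrickEpi (A : E → Set E) : Set (E × E × ℝ) :=
  {c | ∀ y, ∀ v ∈ A y, inner ℝ c.1 v + inner ℝ y c.2.1 - inner ℝ y v ≤ c.2.2}

/-- If `t < ⟪x, u⟫`, the epigraph inequalities make `(x, u)` monotonically related to `A`, hence a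
point of the graph; testing the epigraph condition at that very point gives `⟪x, u⟫ ≤ t`. -/
theorem IsMaximallyMonotone.inner_le_of_mem_fitzpatrickEpi (hA : IsMaximallyMonotone A) {x u : E}
    {t : ℝ} (h : (x, u, t) ∈ fitzpatrickEpi A) : inner ℝ x u ≤ t := by
  by_contra! hlt
  have hmem : u ∈ A x := hA.mem fun y v hv => by
    have := h y v hv
    simp only [inner_sub_left, inner_sub_right] at this ⊢
    linarith
  have := h x u hmem
  simp only at this
  linarith

theorem IsMonotone.mem_fitzpatrickEpi (hA : IsMonotone A) {x u : E} (h : u ∈ A x) :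
    (x, u, inner ℝ x u) ∈ fitzpatrickEpi A := fun y v hv => by
  have := hA _ _ _ h _ hv
  simp only [inner_sub_left, inner_sub_right] at this ⊢
  linarith

theorem convex_fitzpatrickEpi : Convex ℝ (fitzpatrickEpi A) := by
  intro c hc d hd a b ha hb hab y v hv
  have h1 := mul_le_mul_of_nonneg_left (hc y v hv) ha
  have h2 := mul_le_mul_of_nonneg_left (hd y v hv) hb
  simp only [Prod.fst_add, Prod.smul_fst, Prod.snd_add, Prod.smul_snd, inner_add_left,
    inner_add_right, real_inner_smul_left, real_inner_smul_right, smul_eq_mul]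
  have : inner ℝ y v = a * inner ℝ y v + b * inner ℝ y v := by rw [← add_mul, hab, one_mul]
  linarith

/-- The Fitzpatrick function plus half the squared norm attains its infimum. -/
theorem IsMaximallyMonotone.exists_isMinOn [CompleteSpace E] (hA : IsMaximallyMonotone A) :
    ∃ c ∈ fitzpatrickEpi A, ∀ d ∈ fitzpatrickEpi A,
      c.2.2 + (‖c.1‖ ^ 2 + ‖c.2.1‖ ^ 2) / 2 ≤ d.2.2 + (‖d.1‖ ^ 2 + ‖d.2.1‖ ^ 2) / 2 := by
  set f : E × E × ℝ → ℝ := fun c => c.2.2 + (‖c.1‖ ^ 2 + ‖c.2.1‖ ^ 2) / 2 with hf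
  have hbdd : BddBelow (f '' fitzpatrickEpi A) := by
    refine ⟨0, ?_⟩
    rintro _ ⟨c, hc, rfl⟩
    have h1 := hA.inner_le_of_mem_fitzpatrickEpi hc
    have h2 := norm_add_sq_real c.1 c.2.1
    simp only [hf]
    -- The objective is at least `‖x + u‖² / 2`, because `t ≥ ⟪x, u⟫`.
    nlinarith [sq_nonneg ‖c.1 + c.2.1‖]
  have hne : (f '' fitzpatrickEpi A).Nonempty := by
    refine Set.Nonempty.image f ?_
    by_cases h : ∃ x u, u ∈ A x
    · obtain ⟨x, u, hu⟩ := h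
      exact ⟨_, hA.1.mem_fitzpatrickEpi hu⟩
    · push Not at h
      -- An empty graph is not maximal: every pair is vacuously related to it.
      exact absurd (hA.mem fun y v hv => absurd hv (h y v)) (h 0 0)
  set m := sInf (f '' fitzpatrickEpi A) with hm
  have hle : ∀ d ∈ fitzpatrickEpi A, m ≤ f d := fun d hd => csInf_le hbdd ⟨d, hd, rfl⟩
  have hex : ∀ n : ℕ, ∃ c ∈ fitzpatrickEpi A, f c < m + 1 / ((n : ℝ) + 1) := fun n => by
    obtain ⟨_, ⟨c, hc, rfl⟩, h⟩ := exists_lt_of_csInf_lt hne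
      (show m < m + 1 / ((n : ℝ) + 1) from lt_add_of_pos_right _ (by positivity))
    exact ⟨c, hc, h⟩
  choose c hc hcm using hex
  -- Midpoints stay in the convex epigraph, so the parallelogram identity makes a minimizing
  -- sequence Cauchy in its two vector components.
  have hmid : ∀ i j, (‖(c i).1 - (c j).1‖ ^ 2 + ‖(c i).2.1 - (c j).2.1‖ ^ 2) / 8
      ≤ (f (c i) + f (c j)) / 2 - m := fun i j => by
    have h := hle _ (convex_fitzpatrickEpi (hc i) (hc j) (a := 1 / 2) (b := 1 / 2)
      (by norm_num) (by norm_num) (by norm_num))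
    simp only [hf, Prod.fst_add, Prod.smul_fst, Prod.snd_add, Prod.smul_snd, ← smul_add,
      norm_sq_midpoint, smul_eq_mul] at h ⊢
    linarith
  have hbound : ∀ n i j : ℕ, n ≤ i → n ≤ j →
      ‖(c i).1 - (c j).1‖ ^ 2 + ‖(c i).2.1 - (c j).2.1‖ ^ 2 ≤ 8 * (1 / ((n : ℝ) + 1)) := by
    intro n i j hi hj
    have h1 := hmid i j
    have h2 := (hcm i).trans_le (add_le_add_right (Nat.one_div_le_one_div (α := ℝ) hi) m)
    have h3 := (hcm j).trans_le (add_le_add_right (Nat.one_div_le_one_div (α := ℝ) hj) m)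
    linarith
  have hlim : Tendsto (fun n : ℕ => √(8 * (1 / ((n : ℝ) + 1)))) atTop (𝓝 0) := by
    have := (tendsto_one_div_add_atTop_nhds_zero_nat (𝕜 := ℝ)).const_mul 8
    simpa using this.sqrt
  have hc1 : CauchySeq fun n => (c n).1 := by
    refine cauchySeq_of_le_tendsto_0 _ (fun i j n hi hj => ?_) hlim
    rw [dist_eq_norm]
    refine Real.le_sqrt_of_sq_le ?_
    linarith [hbound n i j hi hj, sq_nonneg ‖(c i).2.1 - (c j).2.1‖]
  have hc2 : CauchySeq fun n => (c n).2.1 := by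
    refine cauchySeq_of_le_tendsto_0 _ (fun i j n hi hj => ?_) hlim
    rw [dist_eq_norm]
    refine Real.le_sqrt_of_sq_le ?_
    linarith [hbound n i j hi hj, sq_nonneg ‖(c i).1 - (c j).1‖]
  obtain ⟨x, hx⟩ := cauchySeq_tendsto_of_complete hc1
  obtain ⟨u, hu⟩ := cauchySeq_tendsto_of_complete hc2
  have hfm : Tendsto (fun n => f (c n)) atTop (𝓝 m) := by
    refine tendsto_of_tendsto_of_tendsto_of_le_of_le tendsto_const_nhds ?_
      (fun n => hle _ (hc n)) (fun n => (hcm n).le)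
    simpa using (tendsto_one_div_add_atTop_nhds_zero_nat (𝕜 := ℝ)).const_add m
  -- The objective has no quadratic term in the height, whose limit is instead recovered from the
  -- convergence of the objective.
  have ht : Tendsto (fun n => (c n).2.2) atTop (𝓝 (m - (‖x‖ ^ 2 + ‖u‖ ^ 2) / 2)) := by
    have := hfm.sub (((hx.norm.pow 2).add (hu.norm.pow 2)).div_const 2)
    simpa [hf] using this
  refine ⟨(x, u, m - (‖x‖ ^ 2 + ‖u‖ ^ 2) / 2), fun y v hv => ?_, fun d hd => ?_⟩
  · exact le_of_tendsto_of_tendsto' (((hx.inner tendsto_const_nhds).add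
      (tendsto_const_nhds.inner hu)).sub_const _) ht fun n => hc n y v hv
  · simpa using hle d hd

theorem IsMaximallyMonotone.exists_neg_mem [CompleteSpace E] (hA : IsMaximallyMonotone A) :
    ∃ p, -p ∈ A p := by
  obtain ⟨⟨x, u, t⟩, hc, hmin⟩ := hA.exists_isMinOn
  have ht := hA.inner_le_of_mem_fitzpatrickEpi hc
  have hopt : ∀ y, ∀ v ∈ A y,
      0 ≤ inner ℝ y v - t + inner ℝ x (y - x) + inner ℝ u (v - u) := by
    intro y v hv
    -- First-order optimality of the minimizer along the segment towards `(y, v, ⟪y, v⟫)`; `b` is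
    -- the second-order coefficient.
    refine nonneg_of_forall_add_mul_nonneg (b := (‖y - x‖ ^ 2 + ‖v - u‖ ^ 2) / 2) fun s hs hs1 => ?_
    have h := hmin _ (convex_fitzpatrickEpi hc (hA.1.mem_fitzpatrickEpi hv) (a := 1 - s) (b := s)
      (by linarith) hs.le (by ring))
    simp only [Prod.fst_add, Prod.smul_fst, Prod.snd_add, Prod.smul_snd, smul_eq_mul] at h
    rw [show (1 - s) • x + s • y = x + s • (y - x) by module,
      show (1 - s) • u + s • v = u + s • (v - u) by module, norm_add_sq_real, norm_add_sq_real,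
      norm_smul, norm_smul, mul_pow, mul_pow, Real.norm_eq_abs, sq_abs, real_inner_smul_right,
      real_inner_smul_right] at h
    linarith
  -- With `t ≥ ⟪x, u⟫`, optimality says that `(-u, -x)` is monotonically related to `A`. It is
  -- therefore in the graph, and taking it as `(y, v)` forces `u = -x`.
  have key : ∀ y, ∀ v ∈ A y, ‖x + u‖ ^ 2 ≤ inner ℝ (-u - y) (-x - v) := by
    intro y v hv
    have h := hopt y v hv
    rw [norm_add_sq_real]
    simp only [inner_sub_left, inner_sub_right, inner_neg_left, inner_neg_right,
      real_inner_self_eq_norm_sq] at h ⊢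
    linarith [real_inner_comm x u, real_inner_comm x y]
  have hmem : -x ∈ A (-u) := hA.mem fun y v hv => (sq_nonneg _).trans (key y v hv)
  have h0 : ‖x + u‖ ^ 2 ≤ 0 := by simpa using key _ _ hmem
  have h1 : x + u = 0 := by
    rw [← norm_eq_zero]
    exact pow_eq_zero_iff two_ne_zero |>.1 (le_antisymm h0 (sq_nonneg _))
  rw [neg_eq_of_add_eq_zero_left h1] at hmem
  exact ⟨x, hmem⟩

/-- Minty's theorem. -/
theorem IsMaximallyMonotone.resolvent_nonempty [CompleteSpace E] (hA : IsMaximallyMonotone A)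
    (x : E) : (resolvent A x).Nonempty := by
  obtain ⟨p, hp⟩ := (hA.translate x).exists_neg_mem
  exact ⟨p + x, mem_resolvent.2 (by simpa using hp)⟩

/-- For `(x, u)` monotonically related to `A` and `p` in the resolvent at `x + u`, testing against
`(p, x + u - p)` gives `-‖x - p‖² ≥ 0`, so `p = x`. -/
theorem IsMonotone.isMaximallyMonotone_of_resolvent_nonempty (hA : IsMonotone A)
    (h : ∀ x, (resolvent A x).Nonempty) : IsMaximallyMonotone A := by
  refine isMaximallyMonotone_iff.2 ⟨hA, fun x u hxu => ?_⟩
  obtain ⟨p, hp⟩ := h (x + u)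
  rw [mem_resolvent] at hp
  have h1 := hxu _ _ hp
  rw [show u - (x + u - p) = -(x - p) by abel, inner_neg_right, real_inner_self_eq_norm_sq] at h1
  have h2 : x - p = 0 := by
    rw [← norm_eq_zero]
    exact pow_eq_zero_iff two_ne_zero |>.1 (le_antisymm (by linarith) (sq_nonneg _))
  rw [sub_eq_zero] at h2
  subst h2
  simpa using hp

/-- A selection of the resolvent of `γ • A`. -/
noncomputable def resPt (γ : ℝ) (A : E → Set E) (x : E) : E :=
  Classical.epsilon fun p => p ∈ resolvent (γ • A) x

/-! ### Resolvent estimates, Yosida limits and change of index -/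

section

variable [CompleteSpace E] {γ : ℝ}

theorem IsMaximallyMonotone.resPt_mem (hA : IsMaximallyMonotone A) (hγ : 0 < γ) (x : E) :
    γ⁻¹ • (x - resPt γ A x) ∈ A (resPt γ A x) :=
  (mem_resolvent_smul hγ).1 (Classical.epsilon_spec ((hA.smul hγ).resolvent_nonempty x))

omit [CompleteSpace E] in
theorem IsMonotone.norm_sub_le (hA : IsMonotone A) (hγ : 0 < γ) {x y p q : E}
    (hp : γ⁻¹ • (x - p) ∈ A p) (hq : γ⁻¹ • (y - q) ∈ A q) : ‖p - q‖ ≤ ‖x - y‖ := by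
  have h := mul_nonneg hγ.le (hA _ _ _ hp _ hq)
  rw [← real_inner_smul_right, ← smul_sub, smul_smul, mul_inv_cancel₀ hγ.ne', one_smul,
    show x - p - (y - q) = (x - y) - (p - q) by abel, inner_sub_right,
    real_inner_self_eq_norm_sq] at h
  have h2 := real_inner_le_norm (p - q) (x - y)
  by_contra! h3
  nlinarith [norm_nonneg (x - y), norm_nonneg (p - q)]

theorem IsMaximallyMonotone.eq_resPt (hA : IsMaximallyMonotone A) (hγ : 0 < γ) {x p : E}
    (hp : γ⁻¹ • (x - p) ∈ A p) : p = resPt γ A x := by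
  have h := hA.1.norm_sub_le hγ hp (hA.resPt_mem hγ x)
  rw [sub_self, norm_zero] at h
  exact sub_eq_zero.1 (norm_le_zero_iff.1 h)

theorem IsMaximallyMonotone.resolvent_smul_eq (hA : IsMaximallyMonotone A) (hγ : 0 < γ) (x : E) :
    resolvent (γ • A) x = {resPt γ A x} := by
  ext p
  rw [mem_resolvent_smul hγ, Set.mem_singleton_iff]
  exact ⟨hA.eq_resPt hγ, fun h => h ▸ hA.resPt_mem hγ x⟩

theorem IsMaximallyMonotone.yosida_eq (hA : IsMaximallyMonotone A) (hγ : 0 < γ) (x : E) :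
    yosida γ A x = {γ⁻¹ • (x - resPt γ A x)} := by
  ext q
  rw [mem_yosida hγ, hA.resolvent_smul_eq hγ, Set.mem_singleton_iff, Set.mem_singleton_iff,
    eq_inv_smul_iff₀ hγ.ne']
  exact ⟨fun h => by rw [← h]; abel, fun h => by rw [h]; abel⟩

theorem IsMaximallyMonotone.norm_resPt_sub_resPt_le (hA : IsMaximallyMonotone A) (hγ : 0 < γ)
    (x y : E) : ‖resPt γ A x - resPt γ A y‖ ≤ ‖x - y‖ :=
  hA.1.norm_sub_le hγ (hA.resPt_mem hγ x) (hA.resPt_mem hγ y)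

theorem IsMaximallyMonotone.norm_resPt_sub_le (hA : IsMaximallyMonotone A) (hγ : 0 < γ)
    {x y u : E} (hu : u ∈ A y) : ‖resPt γ A x - y‖ ≤ ‖x - y‖ + γ * ‖u‖ := by
  -- A graph point is itself a resolvent value, so nonexpansiveness applies.
  have h : y = resPt γ A (y + γ • u) :=
    hA.eq_resPt hγ (by rwa [add_sub_cancel_left, smul_smul, inv_mul_cancel₀ hγ.ne', one_smul])
  calc ‖resPt γ A x - y‖ = ‖resPt γ A x - resPt γ A (y + γ • u)‖ := by rw [← h]
    _ ≤ ‖x - (y + γ • u)‖ := hA.norm_resPt_sub_resPt_le hγ _ _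
    _ ≤ ‖x - y‖ + ‖γ • u‖ := by rw [← sub_sub]; exact norm_sub_le _ _
    _ = ‖x - y‖ + γ * ‖u‖ := by rw [norm_smul, Real.norm_of_nonneg hγ.le]

theorem IsMaximallyMonotone.norm_resPt_sub_self_le (hA : IsMaximallyMonotone A) (hγ : 0 < γ)
    {x y u : E} (hu : u ∈ A y) : ‖resPt γ A x - x‖ ≤ 2 * ‖x - y‖ + γ * ‖u‖ := by
  have h1 := hA.norm_resPt_sub_le hγ (x := x) hu
  have h2 := norm_sub_le_norm_sub_add_norm_sub (resPt γ A x) y x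
  rw [norm_sub_rev y x] at h2
  linarith

/-- The squared form, through `(a + b)² ≤ 2a² + 2b²`, supplies integrable dominating functions. -/
theorem IsMaximallyMonotone.norm_sq_resPt_sub_self_le (hA : IsMaximallyMonotone A) (hγ : 0 < γ)
    {x y u : E} (hu : u ∈ A y) :
    ‖resPt γ A x - x‖ ^ 2 ≤ 8 * ‖x - y‖ ^ 2 + 2 * γ ^ 2 * ‖u‖ ^ 2 := by
  have h := pow_le_pow_left₀ (norm_nonneg _) (hA.norm_resPt_sub_self_le hγ (x := x) hu) 2
  nlinarith [sq_nonneg (2 * ‖x - y‖ - γ * ‖u‖)]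

/-- Resolvents converge to the identity on the closure of the domain. -/
theorem IsMaximallyMonotone.tendsto_resPt (hA : IsMaximallyMonotone A) {x : E}
    (hx : x ∈ closure (dom A)) {g : ℕ → ℝ} (hg : ∀ n, 0 < g n) (hg0 : Tendsto g atTop (𝓝 0)) :
    Tendsto (fun n => resPt (g n) A x) atTop (𝓝 x) := by
  rw [Metric.tendsto_atTop]
  intro ε hε
  obtain ⟨y, ⟨u, hu⟩, hy⟩ := Metric.mem_closure_iff.1 hx (ε / 4) (by positivity)
  have h0 : Tendsto (fun n => g n * ‖u‖) atTop (𝓝 0) := by simpa using hg0.mul_const ‖u‖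
  obtain ⟨N, hN⟩ := eventually_atTop.1 (h0.eventually (gt_mem_nhds (show 0 < ε / 2 by positivity)))
  refine ⟨N, fun n hn => ?_⟩
  have h1 := hA.norm_resPt_sub_self_le (hg n) (x := x) hu
  rw [dist_eq_norm] at hy ⊢
  linarith [hN n hn]

omit [CompleteSpace E] in
-- Monotonicity yields `⟪a, b - a⟫ ≥ 0`. Here `a` and `b` are Yosida values at `x` of indices `γ`
-- and `δ`; the case `δ = 0` is included so that `b` may also be any element of `A x`.
theorem IsMonotone.norm_sq_add_norm_sq_le (hA : IsMonotone A) {x a b : E} {δ : ℝ} (hδ : 0 ≤ δ)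
    (hδγ : δ < γ) (ha : a ∈ A (x - γ • a)) (hb : b ∈ A (x - δ • b)) :
    ‖a‖ ^ 2 + ‖b - a‖ ^ 2 ≤ ‖b‖ ^ 2 := by
  have h := hA _ _ _ ha _ hb
  rw [show x - γ • a - (x - δ • b) = δ • (b - a) - (γ - δ) • a by module,
    ← neg_sub b a, inner_neg_right, inner_sub_left, real_inner_smul_left, real_inner_smul_left,
    real_inner_self_eq_norm_sq] at h
  have h1 : 0 ≤ inner ℝ a (b - a) := by
    refine nonneg_of_mul_nonneg_right (a := γ - δ) ?_ (sub_pos.2 hδγ)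
    nlinarith [mul_nonneg hδ (sq_nonneg ‖b - a‖)]
  have h2 := norm_add_sq_real a (b - a)
  rw [add_sub_cancel] at h2
  linarith

/-- Yosida approximations converge to the element of minimal norm. -/
theorem IsMaximallyMonotone.exists_tendsto_yosida (hA : IsMaximallyMonotone A) {x : E}
    (hx : x ∈ dom A) : ∃ p ∈ A x, (∀ b ∈ A x, ‖p‖ ^ 2 + ‖b - p‖ ^ 2 ≤ ‖b‖ ^ 2) ∧
      Tendsto (fun n : ℕ => (1 / ((n : ℝ) + 1))⁻¹ • (x - resPt (1 / ((n : ℝ) + 1)) A x))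
        atTop (𝓝 p) := by
  obtain ⟨b₀, hb₀⟩ := hx
  set g : ℕ → ℝ := fun n => 1 / ((n : ℝ) + 1) with hg
  have hgpos : ∀ n, 0 < g n := fun n => Nat.one_div_pos_of_nat
  set a : ℕ → E := fun n => (g n)⁻¹ • (x - resPt (g n) A x) with ha
  have hres : ∀ n, x - g n • a n = resPt (g n) A x := fun n => by
    rw [ha, smul_inv_smul₀ (hgpos n).ne', sub_sub_cancel]
  have hmem : ∀ n, a n ∈ A (x - g n • a n) := fun n => by
    rw [hres]
    exact hA.resPt_mem (hgpos n) x
  have hle : ∀ b ∈ A x, ∀ n, ‖a n‖ ^ 2 + ‖b - a n‖ ^ 2 ≤ ‖b‖ ^ 2 := fun b hb n =>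
    hA.1.norm_sq_add_norm_sq_le le_rfl (hgpos n) (hmem n) (by simpa using hb)
  have hmono : ∀ i j, i ≤ j → ‖a i‖ ^ 2 + ‖a j - a i‖ ^ 2 ≤ ‖a j‖ ^ 2 := fun i j hij => by
    rcases hij.eq_or_lt with rfl | hij
    · simp
    · exact hA.1.norm_sq_add_norm_sq_le (hgpos j).le (Nat.one_div_lt_one_div hij) (hmem i) (hmem j)
  -- The squared norms increase and are bounded by `‖b₀‖²`; since `‖a j - a i‖² ≤ ‖a j‖² - ‖a i‖²`,
  -- their convergence makes `a` Cauchy.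
  have hnm : Monotone fun n => ‖a n‖ ^ 2 := fun i j hij => by
    have := hmono i j hij
    simp only
    linarith [sq_nonneg ‖a j - a i‖]
  have hbd : BddAbove (Set.range fun n => ‖a n‖ ^ 2) := by
    refine ⟨‖b₀‖ ^ 2, ?_⟩
    rintro _ ⟨n, rfl⟩
    have := hle b₀ hb₀ n
    simp only
    linarith [sq_nonneg ‖b₀ - a n‖]
  have hL := tendsto_atTop_ciSup hnm hbd
  set L := ⨆ n, ‖a n‖ ^ 2
  have hup : ∀ n, ‖a n‖ ^ 2 ≤ L := fun n => le_ciSup hbd n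
  have hdist : ∀ n i, n ≤ i → dist (a i) (a n) ≤ √(L - ‖a n‖ ^ 2) := fun n i hi => by
    rw [dist_eq_norm]
    refine Real.le_sqrt_of_sq_le ?_
    linarith [hmono n i hi, hup i]
  have hcau : CauchySeq a := by
    refine cauchySeq_of_le_tendsto_0 (fun n => 2 * √(L - ‖a n‖ ^ 2)) (fun i j n hi hj => ?_) ?_
    · have := dist_triangle_right (a i) (a j) (a n)
      linarith [hdist n i hi, hdist n j hj]
    · simpa using ((tendsto_const_nhds (x := L)).sub hL).sqrt.const_mul 2
  obtain ⟨p, hp⟩ := cauchySeq_tendsto_of_complete hcau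
  have hg0 : Tendsto g atTop (𝓝 0) := tendsto_one_div_add_atTop_nhds_zero_nat
  have hx' : Tendsto (fun n => x - g n • a n) atTop (𝓝 x) := by
    simpa using (tendsto_const_nhds (x := x)).sub (hg0.smul hp)
  refine ⟨p, hA.mem_of_tendsto hmem hx' hp, fun b hb => ?_, hp⟩
  exact le_of_tendsto' ((hp.norm.pow 2).add ((tendsto_const_nhds.sub hp).norm.pow 2)) (hle b hb)

omit [InnerProductSpace ℝ E] [CompleteSpace E] in
-- The extra term `‖b - p‖²` gives uniqueness directly, with no appeal to convexity of `A x`.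
theorem minSel_eq_singleton {x p : E} (hp : p ∈ A x)
    (h : ∀ b ∈ A x, ‖p‖ ^ 2 + ‖b - p‖ ^ 2 ≤ ‖b‖ ^ 2) : minSel A x = {p} := by
  ext q
  simp only [minSel, proj, zero_sub, norm_neg, Set.mem_ofPred_eq, Set.mem_singleton_iff]
  constructor
  · rintro ⟨hq, hle⟩
    have h1 := h q hq
    have h2 := pow_le_pow_left₀ (norm_nonneg _) (hle p hp) 2
    have h3 : ‖q - p‖ = 0 :=
      pow_eq_zero_iff two_ne_zero |>.1 (le_antisymm (by linarith) (sq_nonneg _))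
    exact sub_eq_zero.1 (norm_eq_zero.1 h3)
  · rintro rfl
    refine ⟨hp, fun b hb => ?_⟩
    have h1 := h b hb
    exact le_of_sq_le_sq (by linarith [sq_nonneg ‖b - q‖]) (norm_nonneg _)

/-- `J_{δA} x` is the limit of the iterates of a contraction built on `J_{γA}`, if `δ > γ / 2`. -/
theorem IsMaximallyMonotone.tendsto_iterate (hA : IsMaximallyMonotone A) (hγ : 0 < γ) {δ : ℝ}
    (hδ : γ / 2 < δ) (x : E) :
    Tendsto (fun n => (fun p => resPt γ A ((γ / δ) • x + (1 - γ / δ) • p))^[n] 0) atTop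
      (𝓝 (resPt δ A x)) := by
  have hδ0 : 0 < δ := by linarith
  set T : E → E := fun p => resPt γ A ((γ / δ) • x + (1 - γ / δ) • p) with hT
  have hk : |1 - γ / δ| < 1 := by
    have h1 : γ / δ < 2 := by rw [div_lt_iff₀ hδ0]; linarith
    have h2 : 0 < γ / δ := by positivity
    rw [abs_lt]
    constructor <;> linarith
  -- For `p = J_{δA} x`, the `T`-argument minus `p` is `(γ / δ) • (x - p)`, so `p` solves the
  -- `γ`-resolvent inclusion there. The Lipschitz constant `|1 - γ / δ|` is below `1` because `δ > γ
  -- / 2`.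
  have hfix : T (resPt δ A x) = resPt δ A x := by
    refine (hA.eq_resPt hγ ?_).symm
    convert hA.resPt_mem hδ0 x using 1
    rw [show (γ / δ) • x + (1 - γ / δ) • resPt δ A x - resPt δ A x
      = (γ / δ) • (x - resPt δ A x) by module, smul_smul]
    congr 1
    field_simp
  have hlip : ∀ p, ‖T p - resPt δ A x‖ ≤ |1 - γ / δ| * ‖p - resPt δ A x‖ := fun p => by
    conv_lhs => rw [← hfix]
    refine (hA.norm_resPt_sub_resPt_le hγ _ _).trans_eq ?_
    rw [add_sub_add_left_eq_sub, ← smul_sub, norm_smul, Real.norm_eq_abs]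
  have hiter : ∀ n, ‖T^[n] 0 - resPt δ A x‖ ≤ |1 - γ / δ| ^ n * ‖resPt δ A x‖ := fun n => by
    induction n with
    | zero => simp
    | succ n ih =>
      rw [Function.iterate_succ_apply', pow_succ', mul_assoc]
      exact (hlip _).trans (mul_le_mul_of_nonneg_left ih (abs_nonneg _))
  rw [tendsto_iff_norm_sub_tendsto_zero]
  refine squeeze_zero (fun _ => norm_nonneg _) hiter ?_
  simpa using (tendsto_pow_atTop_nhds_zero_of_lt_one (abs_nonneg _) hk).mul_const ‖resPt δ A x‖

end

end

end SetOp

namespace MeasurableVectorField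

open Filter Topology SetOp

section

variable {Ω : Type*} [MeasurableSpace Ω] {H : Ω → Type*}
  [∀ ω, NormedAddCommGroup (H ω)] [∀ ω, InnerProductSpace ℝ (H ω)]
  (V : MeasurableVectorField H) (μ : Measure Ω)

/-! ### Measurable and square-integrable fields -/

theorem mem_G_of_tendsto {x : ℕ → ∀ ω, H ω} {y : ∀ ω, H ω} (hx : ∀ n, x n ∈ V.G)
    (hy : ∀ ω, Tendsto (fun n => x n ω) atTop (𝓝 (y ω))) : y ∈ V.G :=
  V.mem_of_measurable_inner y fun _ hz =>
    measurable_of_tendsto_metrizable (fun n => V.measurable_inner (hx n) hz)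
      (tendsto_pi_nhds.2 fun ω => (hy ω).inner tendsto_const_nhds)

theorem smul_mem_G {f : Ω → ℝ} (hf : Measurable f) {x : ∀ ω, H ω} (hx : x ∈ V.G) :
    (fun ω => f ω • x ω) ∈ V.G :=
  V.mem_of_measurable_inner _ fun z hz => by
    simp only [real_inner_smul_left]
    exact hf.mul (V.measurable_inner hx hz)

theorem mem_sqInt_of_norm_sq_le {x : ∀ ω, H ω} (hx : x ∈ V.G) {h : Ω → ℝ} (hh : Integrable h μ)
    (hle : ∀ᵐ ω ∂μ, ‖x ω‖ ^ 2 ≤ h ω) : x ∈ V.sqInt μ := by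
  have hi : Integrable (fun ω => ‖x ω‖ ^ 2) μ :=
    hh.mono' ((V.measurable_norm _ hx).pow_const 2).aestronglyMeasurable
      (hle.mono fun ω hω => by rwa [Real.norm_of_nonneg (sq_nonneg _)])
  refine ⟨hx, ?_⟩
  simpa [HasFiniteIntegral, enorm_pow] using hi.2

/-- Every field in `G` is locally (along a sequence of sets exhausting `Ω`) square-integrable. -/
theorem exists_cutoff [SigmaFinite μ] {x : ∀ ω, H ω} (hx : x ∈ V.G) :
    ∃ y : ℕ → ∀ ω, H ω, (∀ n, y n ∈ V.sqInt μ) ∧ ∀ ω, ∀ᶠ n in atTop, y n ω = x ω := by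
  set S : ℕ → Set Ω := fun n => spanningSets μ n ∩ {ω | ‖x ω‖ ≤ n} with hS
  have hSm : ∀ n, MeasurableSet (S n) := fun n => (measurableSet_spanningSets μ n).inter
    (measurableSet_le (V.measurable_norm x hx) measurable_const)
  refine ⟨fun n ω => (S n).indicator (fun _ => (1 : ℝ)) ω • x ω, fun n => ?_, fun ω => ?_⟩
  · refine V.mem_sqInt_of_norm_sq_le μ (V.smul_mem_G (measurable_const.indicator (hSm n)) hx)
      (h := (S n).indicator fun _ => (n : ℝ) ^ 2) ?_ (ae_of_all _ fun ω => ?_)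
    · refine (integrable_indicator_iff (hSm n)).2 (integrableOn_const ?_)
      exact ((measure_mono Set.inter_subset_left).trans_lt (measure_spanningSets_lt_top μ n)).ne
    · by_cases h : ω ∈ S n
      · simpa [h] using pow_le_pow_left₀ (norm_nonneg _) h.2 2
      · simp [h]
  · obtain ⟨N, hN⟩ := exists_nat_ge ‖x ω‖
    filter_upwards [eventually_ge_atTop N, eventually_ge_atTop (spanningSetsIndex μ ω)] with n h1 h2
    have : ω ∈ S n := ⟨mem_spanningSets_of_index_le μ ω h2, hN.trans (Nat.cast_le.2 h1)⟩
    simp [this]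

/-! ### Classes, representatives and convergence -/

theorem toClass_surjective : Function.Surjective (V.toClass μ) :=
  fun X => ⟨_, V.toClass_rep μ X⟩

theorem norm_toClass_sq (x : V.sqInt μ) : ‖V.toClass μ x‖ ^ 2 = ∫ ω, ‖x.1 ω‖ ^ 2 ∂μ := by
  rw [← real_inner_self_eq_norm_sq]
  refine integral_congr_ae ?_
  filter_upwards [V.rep_toClass μ x] with ω hω
  rw [hω, real_inner_self_eq_norm_sq]

theorem inner_toClass (x y : V.sqInt μ) :
    inner ℝ (V.toClass μ x) (V.toClass μ y) = ∫ ω, inner ℝ (x.1 ω) (y.1 ω) ∂μ := by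
  refine integral_congr_ae ?_
  filter_upwards [V.rep_toClass μ x, V.rep_toClass μ y] with ω h1 h2
  rw [h1, h2]

theorem mem_setIntegral {C : ∀ ω, Set (H ω)} {X : V.DirectIntegral μ} :
    X ∈ V.setIntegral μ C ↔ ∀ᵐ ω ∂μ, (V.rep μ X).1 ω ∈ C ω := Iff.rfl

theorem mem_opIntegral {A : ∀ ω, H ω → Set (H ω)} {X U : V.DirectIntegral μ} :
    U ∈ V.opIntegral μ A X ↔ ∀ᵐ ω ∂μ, (V.rep μ U).1 ω ∈ A ω ((V.rep μ X).1 ω) := Iff.rfl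

theorem toClass_mem_setIntegral {C : ∀ ω, Set (H ω)} {x : V.sqInt μ} :
    V.toClass μ x ∈ V.setIntegral μ C ↔ ∀ᵐ ω ∂μ, x.1 ω ∈ C ω :=
  (V.mem_setIntegral μ).trans <| eventually_congr ((V.rep_toClass μ x).mono fun ω hω => by rw [hω])

theorem toClass_mem_opIntegral {A : ∀ ω, H ω → Set (H ω)} {x u : V.sqInt μ} :
    V.toClass μ u ∈ V.opIntegral μ A (V.toClass μ x) ↔ ∀ᵐ ω ∂μ, u.1 ω ∈ A ω (x.1 ω) := by
  refine (V.mem_opIntegral μ).trans (eventually_congr ?_)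
  filter_upwards [V.rep_toClass μ x, V.rep_toClass μ u] with ω h1 h2
  rw [h1, h2]

theorem tendsto_toClass {x : ℕ → V.sqInt μ} {y : V.sqInt μ} {h : Ω → ℝ} (hh : Integrable h μ)
    (hle : ∀ n, ∀ᵐ ω ∂μ, ‖(x n).1 ω - y.1 ω‖ ^ 2 ≤ h ω)
    (hlim : ∀ᵐ ω ∂μ, Tendsto (fun n => (x n).1 ω) atTop (𝓝 (y.1 ω))) :
    Tendsto (fun n => V.toClass μ (x n)) atTop (𝓝 (V.toClass μ y)) := by
  have hint : Tendsto (fun n => ∫ ω, ‖(x n - y).1 ω‖ ^ 2 ∂μ) atTop (𝓝 (∫ _, (0 : ℝ) ∂μ)) := by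
    refine tendsto_integral_of_dominated_convergence h
      (fun n => (V.integrable_norm_sq μ (x n - y)).aestronglyMeasurable) hh (fun n => ?_) ?_
    · filter_upwards [hle n] with ω hω
      rwa [Real.norm_of_nonneg (sq_nonneg _)]
    · filter_upwards [hlim] with ω hω
      simpa using (tendsto_iff_norm_sub_tendsto_zero.1 hω).pow 2
  rw [tendsto_iff_norm_sub_tendsto_zero]
  have h2 := hint.sqrt
  simp only [← norm_toClass_sq, Real.sqrt_sq (norm_nonneg _), integral_zero, Real.sqrt_zero,
    map_sub] at h2
  exact h2

/-- A convergent sequence in the direct integral has an a.e. convergent subsequence. -/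
theorem exists_subseq_tendsto_ae {x : ℕ → V.sqInt μ} {y : V.sqInt μ}
    (h : Tendsto (fun n => V.toClass μ (x n)) atTop (𝓝 (V.toClass μ y))) :
    ∃ φ : ℕ → ℕ, StrictMono φ ∧
      ∀ᵐ ω ∂μ, Tendsto (fun n => (x (φ n)).1 ω) atTop (𝓝 (y.1 ω)) := by
  have hint := fun n => V.integrable_norm_sq μ (x n - y)
  -- The fibres vary with `ω`, so convergence in measure is applied to the real functions `‖x n -
  -- y‖²`, which tend to `0` in `L¹`.
  have hlim : Tendsto (fun n => eLpNorm ((fun ω => ‖(x n - y).1 ω‖ ^ 2) - fun _ => (0 : ℝ)) 1 μ)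
      atTop (𝓝 0) := by
    have h1 := (tendsto_iff_norm_sub_tendsto_zero.1 h).pow 2
    simp only [← map_sub, norm_toClass_sq, ne_eq, OfNat.ofNat_ne_zero, not_false_eq_true,
      zero_pow] at h1
    have h2 := ENNReal.tendsto_ofReal h1
    rw [ENNReal.ofReal_zero] at h2
    refine h2.congr fun n => ?_
    rw [eLpNorm_one_eq_lintegral_enorm, ofReal_integral_eq_lintegral_ofReal (hint n)
      (ae_of_all _ fun _ => sq_nonneg _)]
    refine lintegral_congr fun ω => ?_
    simp [Real.enorm_of_nonneg (sq_nonneg _), -enorm_pow]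
  obtain ⟨φ, hφ, hae⟩ := (tendstoInMeasure_of_tendsto_eLpNorm one_ne_zero
    (fun n => (hint n).aestronglyMeasurable) aestronglyMeasurable_const hlim).exists_seq_tendsto_ae
  refine ⟨φ, hφ, hae.mono fun ω hω => ?_⟩
  rw [tendsto_iff_norm_sub_tendsto_zero]
  have h2 := hω.sqrt
  simp only [Real.sqrt_sq (norm_nonneg _), Real.sqrt_zero] at h2
  exact h2

theorem isClosed_setIntegral {C : ∀ ω, Set (H ω)} (hC : ∀ ω, IsClosed (C ω)) :
    IsClosed (V.setIntegral μ C) := by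
  refine IsSeqClosed.isClosed fun X Y hX hXY => ?_
  choose x hx using fun n => V.toClass_surjective μ (X n)
  obtain ⟨y, rfl⟩ := V.toClass_surjective μ Y
  obtain rfl : X = fun n => V.toClass μ (x n) := funext fun n => (hx n).symm
  simp only [ toClass_mem_setIntegral] at hX hXY ⊢
  obtain ⟨φ, -, hφ⟩ := V.exists_subseq_tendsto_ae μ hXY
  filter_upwards [hφ, ae_all_iff.2 fun n => hX (φ n)] with ω h1 h2
  exact (hC ω).mem_of_tendsto h1 (Eventually.of_forall h2)

theorem setIntegral_mono {C D : ∀ ω, Set (H ω)} (h : ∀ ω, C ω ⊆ D ω) :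
    V.setIntegral μ C ⊆ V.setIntegral μ D := fun _ hx =>
  (V.mem_setIntegral μ).2 (((V.mem_setIntegral μ).1 hx).mono fun ω hω => h ω hω)

/-! ### Fibrewise calculus of direct integrals of operators -/

variable {A : ∀ ω, H ω → Set (H ω)}

theorem isMonotone_opIntegral (hA : ∀ ω, IsMonotone (A ω)) : IsMonotone (V.opIntegral μ A) := by
  intro X Y U hU W hW
  obtain ⟨x, rfl⟩ := V.toClass_surjective μ X
  obtain ⟨y, rfl⟩ := V.toClass_surjective μ Y
  obtain ⟨u, rfl⟩ := V.toClass_surjective μ U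
  obtain ⟨w, rfl⟩ := V.toClass_surjective μ W
  rw [toClass_mem_opIntegral] at hU hW
  rw [← map_sub, ← map_sub, inner_toClass]
  refine integral_nonneg_of_ae ?_
  filter_upwards [hU, hW] with ω h1 h2
  exact hA ω _ _ _ h1 _ h2

theorem inv_opIntegral : inv (V.opIntegral μ A) = V.opIntegral μ fun ω => inv (A ω) := rfl

theorem resolvent_smul_opIntegral {γ : ℝ} (hγ : 0 < γ) : resolvent (γ • V.opIntegral μ A) =
    V.opIntegral μ fun ω => resolvent (γ • A ω) := by
  ext X P
  obtain ⟨x, rfl⟩ := V.toClass_surjective μ X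
  obtain ⟨p, rfl⟩ := V.toClass_surjective μ P
  rw [mem_resolvent_smul hγ, ← map_sub, ← map_smul, toClass_mem_opIntegral, toClass_mem_opIntegral]
  exact eventually_congr (ae_of_all _ fun ω => (mem_resolvent_smul hγ).symm)

theorem yosida_opIntegral {γ : ℝ} (hγ : 0 < γ) : yosida γ (V.opIntegral μ A) =
    V.opIntegral μ fun ω => yosida γ (A ω) := by
  ext X Q
  obtain ⟨x, rfl⟩ := V.toClass_surjective μ X
  obtain ⟨q, rfl⟩ := V.toClass_surjective μ Q
  rw [mem_yosida hγ, resolvent_smul_opIntegral V μ hγ, ← map_smul, ← map_sub,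
    toClass_mem_opIntegral, toClass_mem_opIntegral]
  exact eventually_congr (ae_of_all _ fun ω => (mem_yosida hγ).symm)

theorem dom_opIntegral_subset : dom (V.opIntegral μ A) ⊆ V.setIntegral μ fun ω => dom (A ω) :=
  fun _ ⟨_, hU⟩ =>
  (V.mem_setIntegral μ).2 (((V.mem_opIntegral μ).1 hU).mono fun _ hω => ⟨_, hω⟩)

/-! ### Measurable resolvents and the assertions of the theorem -/

section

variable [∀ ω, CompleteSpace (H ω)]

theorem resPt_mem_G_of_lt (hA : ∀ ω, IsMaximallyMonotone (A ω)) {γ δ : ℝ} (hγ : 0 < γ)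
    (hδ : γ / 2 < δ) (h : ∀ x ∈ V.G, (fun ω => resPt γ (A ω) (x ω)) ∈ V.G) :
    ∀ x ∈ V.G, (fun ω => resPt δ (A ω) (x ω)) ∈ V.G := by
  intro x hx
  refine V.mem_G_of_tendsto (fun n => ?_) fun ω => (hA ω).tendsto_iterate hγ hδ (x ω)
  induction n with
  | zero => exact V.G.zero_mem
  | succ n ih =>
    simp only [Function.iterate_succ_apply']
    exact h _ (V.G.add_mem (V.G.smul_mem _ hx) (V.G.smul_mem _ ih))

theorem resPt_mem_G [SigmaFinite μ] (hA : ∀ ω, IsMaximallyMonotone (A ω))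
    (hJ : ∀ x ∈ V.sqInt μ, ∀ p : ∀ ω, H ω,
      (∀ ω, p ω ∈ SetOp.resolvent (A ω) (x ω)) → p ∈ V.G) {γ : ℝ} (hγ : 0 < γ) :
    ∀ x ∈ V.G, (fun ω => resPt γ (A ω) (x ω)) ∈ V.G := by
  have h1 : ∀ x ∈ V.G, (fun ω => resPt 1 (A ω) (x ω)) ∈ V.G := by
    intro x hx
    obtain ⟨y, hy, hyx⟩ := V.exists_cutoff μ hx
    -- The hypothesis covers square-integrable fields only; the cutoffs agree with `x` at each `ω`
    -- from some index on.
    refine V.mem_G_of_tendsto (x := fun n ω => resPt 1 (A ω) (y n ω)) (fun n => ?_) fun ω =>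
      tendsto_const_nhds.congr' ((hyx ω).mono fun n hn => by simp only [hn])
    refine hJ _ (hy n) _ fun ω => ?_
    simpa [mem_resolvent] using (hA ω).resPt_mem one_pos (y n ω)
  -- Any ratio in `(1/2, 1)` would do: descend below `γ` by factors `2 / 3`, then reach `γ` in one
  -- move, as increasing the index is always allowed.
  have hpow : ∀ n : ℕ, ∀ x ∈ V.G, (fun ω => resPt ((2 / 3 : ℝ) ^ n) (A ω) (x ω)) ∈ V.G := by
    intro n
    induction n with
    | zero => simpa using h1
    | succ n ih =>
      refine V.resPt_mem_G_of_lt hA (by positivity) ?_ ih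
      have : (0 : ℝ) < (2 / 3) ^ n := by positivity
      rw [pow_succ]
      linarith
  obtain ⟨n, hn⟩ := exists_pow_lt_of_lt_one hγ (show (2 / 3 : ℝ) < 1 by norm_num)
  refine V.resPt_mem_G_of_lt hA (γ := (2 / 3) ^ n) (by positivity) ?_ (hpow n)
  have : (0 : ℝ) < (2 / 3) ^ n := by positivity
  linarith

variable (hA : ∀ ω, IsMaximallyMonotone (A ω))
  (hG : ∀ γ : ℝ, 0 < γ → ∀ x ∈ V.G, (fun ω => resPt γ (A ω) (x ω)) ∈ V.G)
  (hdom : (dom (V.opIntegral μ A)).Nonempty)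

include hA hG hdom

theorem resPt_mem_sqInt {γ : ℝ} (hγ : 0 < γ) {x : ∀ ω, H ω} (hx : x ∈ V.sqInt μ) :
    (fun ω => resPt γ (A ω) (x ω)) ∈ V.sqInt μ := by
  obtain ⟨R, U, hU⟩ := hdom
  obtain ⟨r, rfl⟩ := V.toClass_surjective μ R
  obtain ⟨u, rfl⟩ := V.toClass_surjective μ U
  rw [toClass_mem_opIntegral] at hU
  lift x to V.sqInt μ using hx
  have h : (fun ω => resPt γ (A ω) (x.1 ω) - x.1 ω) ∈ V.sqInt μ := by
    refine V.mem_sqInt_of_norm_sq_le μ (V.G.sub_mem (hG γ hγ _ x.2.1) x.2.1)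
      (((V.integrable_norm_sq μ (x - r)).const_mul 8).add
        ((V.integrable_norm_sq μ u).const_mul (2 * γ ^ 2))) ?_
    filter_upwards [hU] with ω hω
    exact (hA ω).norm_sq_resPt_sub_self_le hγ hω
  convert (V.sqInt μ).add_mem h x.2 using 1
  funext ω
  simp

theorem isMaximallyMonotone_opIntegral : IsMaximallyMonotone (V.opIntegral μ A) := by
  refine (V.isMonotone_opIntegral μ fun ω => (hA ω).1).isMaximallyMonotone_of_resolvent_nonempty
    fun X => ?_
  obtain ⟨x, rfl⟩ := V.toClass_surjective μ X
  refine ⟨V.toClass μ ⟨_, V.resPt_mem_sqInt μ hA hG hdom one_pos x.2⟩, ?_⟩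
  rw [mem_resolvent, ← map_sub, toClass_mem_opIntegral]
  refine ae_of_all _ fun ω => ?_
  simpa using (hA ω).resPt_mem one_pos (x.1 ω)

/-- The resolvent values of index `1 / (n + 1)` lie in the domain of the direct integral and
converge to `x` by dominated convergence; indices at most `1` give a bound independent of `n`. -/
theorem setIntegral_closure_dom_subset :
    V.setIntegral μ (fun ω => closure (dom (A ω))) ⊆ closure (dom (V.opIntegral μ A)) := by
  intro X hX
  obtain ⟨x, rfl⟩ := V.toClass_surjective μ X
  rw [toClass_mem_setIntegral] at hX
  have hg : ∀ n : ℕ, (0 : ℝ) < 1 / ((n : ℝ) + 1) := fun n => Nat.one_div_pos_of_nat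
  have hp := fun n => V.resPt_mem_sqInt μ hA hG hdom (hg n) x.2
  obtain ⟨R, U, hU⟩ := hdom
  obtain ⟨r, rfl⟩ := V.toClass_surjective μ R
  obtain ⟨u, rfl⟩ := V.toClass_surjective μ U
  rw [toClass_mem_opIntegral] at hU
  refine mem_closure_of_tendsto (V.tendsto_toClass μ (x := fun n => ⟨_, hp n⟩) (y := x)
    (((V.integrable_norm_sq μ (x - r)).const_mul 8).add
        ((V.integrable_norm_sq μ u).const_mul 2)) (fun n => ?_) ?_)
    (Eventually.of_forall fun n => ?_)
  · filter_upwards [hU] with ω hω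
    refine ((hA ω).norm_sq_resPt_sub_self_le (hg n) hω).trans (add_le_add le_rfl ?_)
    have h1 : (1 / ((n : ℝ) + 1)) ^ 2 ≤ 1 := by
      refine pow_le_one₀ (hg n).le ?_
      rw [div_le_one (by positivity)]
      linarith [n.cast_nonneg (α := ℝ)]
    change _ ≤ 2 * ‖u.1 ω‖ ^ 2
    nlinarith [sq_nonneg ‖u.1 ω‖]
  · filter_upwards [hX] with ω hω
    exact (hA ω).tendsto_resPt hω hg tendsto_one_div_add_atTop_nhds_zero_nat
  · refine ⟨V.toClass μ ((1 / ((n : ℝ) + 1))⁻¹ • (x - ⟨_, hp n⟩)), ?_⟩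
    rw [toClass_mem_opIntegral]
    exact ae_of_all _ fun ω => (hA ω).resPt_mem (hg n) _

theorem closure_dom_opIntegral :
    closure (dom (V.opIntegral μ A)) = V.setIntegral μ (fun ω => closure (dom (A ω))) ∧
      V.setIntegral μ (fun ω => closure (dom (A ω))) =
        closure (V.setIntegral μ (fun ω => dom (A ω))) := by
  have h1 := closure_mono (V.dom_opIntegral_subset μ (A := A))
  have h2 : closure (V.setIntegral μ fun ω => dom (A ω)) ⊆
      V.setIntegral μ fun ω => closure (dom (A ω)) :=
    closure_minimal (V.setIntegral_mono μ fun ω => subset_closure)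
      (V.isClosed_setIntegral μ fun ω => isClosed_closure)
  have h3 := V.setIntegral_closure_dom_subset μ hA hG hdom
  exact ⟨(h1.trans h2).antisymm h3, (h3.trans h1).antisymm h2⟩

omit hdom in
theorem exists_minSel_eq (x : V.sqInt μ) (hx : ∀ ω, x.1 ω ∈ dom (A ω)) :
    (∃ p ∈ V.G, ∀ ω, minSel (A ω) (x.1 ω) = {p ω}) ∧
      (V.toClass μ x ∈ dom (V.opIntegral μ A) →
        ∃ p : V.sqInt μ, (∀ ω, minSel (A ω) (x.1 ω) = {p.1 ω}) ∧
          minSel (V.opIntegral μ A) (V.toClass μ x) = {V.toClass μ p}) := by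
  choose p hpA hpmin hlim using fun ω => (hA ω).exists_tendsto_yosida (hx ω)
  have hpG : p ∈ V.G := V.mem_G_of_tendsto (fun n => V.G.smul_mem _ (V.G.sub_mem x.2.1
    (hG _ Nat.one_div_pos_of_nat _ x.2.1))) hlim
  have hmin : ∀ ω, minSel (A ω) (x.1 ω) = {p ω} :=
    fun ω => minSel_eq_singleton (hpA ω) (hpmin ω)
  refine ⟨⟨p, hpG, hmin⟩, ?_⟩
  rintro ⟨B, hB⟩
  obtain ⟨b, rfl⟩ := V.toClass_surjective μ B
  rw [toClass_mem_opIntegral] at hB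
  have hp : p ∈ V.sqInt μ := by
    refine V.mem_sqInt_of_norm_sq_le μ hpG (V.integrable_norm_sq μ b) ?_
    filter_upwards [hB] with ω hω
    -- Fibrewise minimality bounds `p` by any square-integrable selection `b`.
    linarith [hpmin ω _ hω, sq_nonneg ‖b.1 ω - p ω‖]
  refine ⟨⟨p, hp⟩, hmin, minSel_eq_singleton
    ((V.toClass_mem_opIntegral μ).2 (ae_of_all _ hpA)) fun C hC => ?_⟩
  obtain ⟨c, rfl⟩ := V.toClass_surjective μ C
  rw [toClass_mem_opIntegral] at hC
  rw [← map_sub, norm_toClass_sq, norm_toClass_sq, norm_toClass_sq,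
    ← integral_add (V.integrable_norm_sq μ _) (V.integrable_norm_sq μ _)]
  refine integral_mono_ae ((V.integrable_norm_sq μ _).add (V.integrable_norm_sq μ _))
    (V.integrable_norm_sq μ _) ?_
  filter_upwards [hC] with ω hω
  exact hpmin ω _ hω

end

end

end MeasurableVectorField

theorem theoremt {Ω : Type*} [MeasurableSpace Ω] (μ : Measure Ω) [μ.IsComplete] [SigmaFinite μ]
    {H : Ω → Type*} [∀ ω, NormedAddCommGroup (H ω)] [∀ ω, InnerProductSpace ℝ (H ω)]
    [∀ ω, CompleteSpace (H ω)]
    (V : MeasurableVectorField H) (A : ∀ ω, H ω → Set (H ω))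
    (hA : ∀ ω, SetOp.IsMaximallyMonotone (A ω))
    (hJ : ∀ x ∈ V.sqInt μ, ∀ p : ∀ ω, H ω,
      (∀ ω, p ω ∈ SetOp.resolvent (A ω) (x ω)) → p ∈ V.G)
    (hdom : (SetOp.dom (V.opIntegral μ A)).Nonempty) :
    -- maximal monotonicity
    SetOp.IsMaximallyMonotone (V.opIntegral μ A) ∧
    -- resolvents and Yosida approximations
    (∀ γ : ℝ, 0 < γ → ∀ x ∈ V.sqInt μ,
      ((∃ p ∈ V.sqInt μ, ∀ ω, SetOp.resolvent (γ • A ω) (x ω) = {p ω}) ∧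
        SetOp.resolvent (γ • V.opIntegral μ A) =
          V.opIntegral μ (fun ω => SetOp.resolvent (γ • A ω))) ∧
      ((∃ p ∈ V.sqInt μ, ∀ ω, SetOp.yosida γ (A ω) (x ω) = {p ω}) ∧
        SetOp.yosida γ (V.opIntegral μ A) =
          V.opIntegral μ (fun ω => SetOp.yosida γ (A ω)))) ∧
    -- closure of the domain
    (closure (SetOp.dom (V.opIntegral μ A)) =
        V.setIntegral μ (fun ω => closure (SetOp.dom (A ω))) ∧
      V.setIntegral μ (fun ω => closure (SetOp.dom (A ω))) =
        closure (V.setIntegral μ (fun ω => SetOp.dom (A ω)))) ∧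
    -- closure of the range
    (closure (SetOp.ran (V.opIntegral μ A)) =
        V.setIntegral μ (fun ω => closure (SetOp.ran (A ω))) ∧
      V.setIntegral μ (fun ω => closure (SetOp.ran (A ω))) =
        closure (V.setIntegral μ (fun ω => SetOp.ran (A ω)))) ∧
    -- minimal-norm selection
    (∀ x : V.sqInt μ, (∀ ω, x.1 ω ∈ SetOp.dom (A ω)) →
      (∃ p ∈ V.G, ∀ ω, SetOp.minSel (A ω) (x.1 ω) = {p ω}) ∧
      (V.toClass μ x ∈ SetOp.dom (V.opIntegral μ A) →
        ∃ p : V.sqInt μ, (∀ ω, SetOp.minSel (A ω) (x.1 ω) = {p.1 ω}) ∧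
          SetOp.minSel (V.opIntegral μ A) (V.toClass μ x) = {V.toClass μ p})) := by
  have hG := fun γ (hγ : (0 : ℝ) < γ) => V.resPt_mem_G μ hA hJ hγ
  have hGinv := fun γ (hγ : (0 : ℝ) < γ) => V.resPt_mem_G μ (fun ω => (hA ω).inv)
    (fun x hx p hp => by
      -- If `p` is a resolvent value of the inverse at `x`, then `x - p` is one of `A`, so the
      -- hypothesis passes to the inverses.
      have h := hJ x hx (x - p) fun ω => by
        have := SetOp.mem_resolvent.1 (hp ω)
        rw [SetOp.mem_resolvent]
        simpa [SetOp.inv] using this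
      simpa using V.G.sub_mem hx.1 h) hγ
  refine ⟨V.isMaximallyMonotone_opIntegral μ hA hG hdom, fun γ hγ x hx => ?_,
    V.closure_dom_opIntegral μ hA hG hdom, ?_, V.exists_minSel_eq μ hA hG⟩
  · have hp := V.resPt_mem_sqInt μ hA hG hdom hγ hx
    refine ⟨⟨⟨fun ω => SetOp.resPt γ (A ω) (x ω), hp, fun ω => (hA ω).resolvent_smul_eq hγ _⟩,
      V.resolvent_smul_opIntegral μ hγ⟩, ⟨fun ω => γ⁻¹ • (x ω - SetOp.resPt γ (A ω) (x ω)), ?_,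
        fun ω => (hA ω).yosida_eq hγ _⟩, V.yosida_opIntegral μ hγ⟩
    exact (V.sqInt μ).smul_mem γ⁻¹ ((V.sqInt μ).sub_mem hx hp)
  -- Ranges are domains of inverses, and inversion commutes with the direct integral.
  · simp only [← SetOp.dom_inv, V.inv_opIntegral μ]
    refine V.closure_dom_opIntegral μ (A := fun ω => SetOp.inv (A ω)) (fun ω => (hA ω).inv) hGinv ?_
    obtain ⟨x, u, hu⟩ := hdom
    exact ⟨u, x, hu⟩
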